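/- Setting. A Markov chain (MC) is a tuple $(M,\tau,\ell)$ with $M$ a finite nonempty set of states, $\tau$ assigning to each state a probability distribution on $M$, and $\ell\colon M\to L$ a labelling. The Kantorovich lifting of a $1$-bounded pseudometric $d$ on $M$ is $\mathcal K(d)(\mu,\nu)=\min_\omega\sum_{u,v}d(u,v)\,\omega(u,v)$, with $\omega$ ranging over the couplings of $\mu$ and $\nu$. The undiscounted bisimilarity distance on $M$ is the least fixed point, in the pointwise order on $1$-bounded pseudometrics on $M$, of $\Psi(d)(m,n)=1$ if $\ell(m)\neq\ell(n)$ and $\Psi(d)(m,n)=\mathcal K(d)(\tau(m),\tau(n))$ otherwise. For two MCs with initial states, $\delta_1(\mathcal M,\mathcal N)$ is the undiscounted bisimilarity distance of their initial states in the disjoint union of $\mathcal M$ and $\mathcal N$. An MC $\mathcal N$ with initial state is a closest $k$-state approximant of $\mathcal M$ if it has at most $k$ states and $\delta_1(\mathcal M,\mathcal N)\le\delta_1(\mathcal M,\mathcal N')$ for every MC $\mathcal N'$ with initial state and at most $k$ states. Let red, blue, green be three distinct labels. Let $\mathcal M$ be the MC with states $m_0,\dots,m_4$, initial state $m_0$,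 where $m_0,m_1,m_2$ are red, $m_3$ is blue, $m_4$ is green; for $i=0,1,2$ the state $m_i$ moves to $m_{i+1}$ with probability $\frac{79}{100}$ and to $m_4$ with probability $\frac{21}{100}$; $m_3$ and $m_4$ are absorbing. For $x,y\ge 0$ with $x+y\le1$ let $\mathcal N_{xy}$ be the MC with states $n_0$ (red, initial), $n_1$ (blue), $n_2$ (green), where $n_0$ moves to $n_0,n_1,n_2$ with probabilities $x$, $1-x-y$, $y$, and $n_1,n_2$ are absorbing. Then, for $x=\frac1{30}(10+\sqrt{163})$ and $y=\frac{21}{100}$ (which satisfy $x,y\ge0$ and $x+y\le 1$): 1. $\mathcal N_{xy}$ is a closest $3$-state approximant of the MC $\mathcal M$, which has $5$ states and rational transition probabilities; 2. $\delta_1(\mathcal M,\mathcal N_{xy})=\frac{436}{675}-\frac{163\sqrt{163}}{13500}$, and this number is irrational; 3. every closest $3$-state approximant of $\mathcal M$ has some irrational transition probability. -/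

import Mathlib

namespace MarkovApprox

noncomputable section

open scoped BigOperators

/-! ## Couplings and the Kantorovich lifting

A probability distribution on a finite set `X` is an element of `stdSimplex ℝ X`. -/

section Kantorovich

variable {X : Type*} [Fintype X]

/-- The couplings of `μ` and `ν`: the distributions on `X × X` whose left marginal is `μ` and whose
right marginal is `ν`. -/
def couplings (μ ν : stdSimplex ℝ X) : Set (stdSimplex ℝ (X × X)) :=
  {ω | (∀ y, ∑ x, ω (x, y) = ν y) ∧ (∀ x, ∑ y, ω (x, y) = μ x)}

/-- The expected value of `d` under the joint distribution `ω`. -/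
def transportCost (d : X → X → ℝ) (ω : stdSimplex ℝ (X × X)) : ℝ :=
  ∑ x, ∑ y, d x y * ω (x, y)

/-- The Kantorovich lifting of `d`: the least expected value of `d` over all couplings. -/
def kantorovich (d : X → X → ℝ) (μ ν : stdSimplex ℝ X) : ℝ :=
  sInf (transportCost d '' couplings μ ν)

theorem couplings_nonempty (μ ν : stdSimplex ℝ X) : (couplings μ ν).Nonempty := by
  refine ⟨⟨fun p => μ p.1 * ν p.2, fun p => mul_nonneg (stdSimplex.zero_le _ _)
    (stdSimplex.zero_le _ _), ?_⟩, ?_, ?_⟩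
  · rw [Fintype.sum_prod_type]
    simp [← Finset.mul_sum]
  · intro y
    change ∑ x, μ x * ν y = ν y
    simp [← Finset.sum_mul]
  · intro x
    change ∑ y, μ x * ν y = μ x
    simp [← Finset.mul_sum]

theorem transportCost_nonneg {d : X → X → ℝ} (hd : ∀ x y, 0 ≤ d x y)
    (ω : stdSimplex ℝ (X × X)) : 0 ≤ transportCost d ω :=
  Finset.sum_nonneg fun _ _ => Finset.sum_nonneg fun _ _ =>
    mul_nonneg (hd _ _) (stdSimplex.zero_le _ _)

theorem transportCost_mono {d e : X → X → ℝ} (h : ∀ x y, d x y ≤ e x y)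
    (ω : stdSimplex ℝ (X × X)) : transportCost d ω ≤ transportCost e ω :=
  Finset.sum_le_sum fun _ _ => Finset.sum_le_sum fun _ _ =>
    mul_le_mul_of_nonneg_right (h _ _) (stdSimplex.zero_le _ _)

theorem transportCost_le_one {d : X → X → ℝ} (hd : ∀ x y, d x y ≤ 1)
    (ω : stdSimplex ℝ (X × X)) : transportCost d ω ≤ 1 := by
  refine (transportCost_mono (e := fun _ _ => 1) hd ω).trans (le_of_eq ?_)
  have h := stdSimplex.sum_eq_one ω
  rw [Fintype.sum_prod_type] at h
  simpa [transportCost] using h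

theorem bddBelow_transportCost {d : X → X → ℝ} (hd : ∀ x y, 0 ≤ d x y) (μ ν : stdSimplex ℝ X) :
    BddBelow (transportCost d '' couplings μ ν) :=
  ⟨0, by rintro _ ⟨ω, -, rfl⟩; exact transportCost_nonneg hd ω⟩

theorem kantorovich_le {d : X → X → ℝ} (hd : ∀ x y, 0 ≤ d x y) {μ ν : stdSimplex ℝ X}
    {ω : stdSimplex ℝ (X × X)} (hω : ω ∈ couplings μ ν) :
    kantorovich d μ ν ≤ transportCost d ω :=
  csInf_le (bddBelow_transportCost hd μ ν) ⟨ω, hω, rfl⟩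

theorem le_kantorovich {d : X → X → ℝ} {μ ν : stdSimplex ℝ X} {c : ℝ}
    (h : ∀ ω ∈ couplings μ ν, c ≤ transportCost d ω) : c ≤ kantorovich d μ ν :=
  le_csInf ((couplings_nonempty μ ν).image _) (by rintro _ ⟨ω, hω, rfl⟩; exact h ω hω)

theorem kantorovich_nonneg {d : X → X → ℝ} (hd : ∀ x y, 0 ≤ d x y) (μ ν : stdSimplex ℝ X) :
    0 ≤ kantorovich d μ ν :=
  le_kantorovich fun ω _ => transportCost_nonneg hd ω

theorem kantorovich_le_one {d : X → X → ℝ} (hd : ∀ x y, 0 ≤ d x y) (hd' : ∀ x y, d x y ≤ 1)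
    (μ ν : stdSimplex ℝ X) : kantorovich d μ ν ≤ 1 := by
  obtain ⟨ω, hω⟩ := couplings_nonempty μ ν
  exact (kantorovich_le hd hω).trans (transportCost_le_one hd' ω)

theorem kantorovich_mono {d e : X → X → ℝ} (hd : ∀ x y, 0 ≤ d x y) (h : ∀ x y, d x y ≤ e x y)
    (μ ν : stdSimplex ℝ X) : kantorovich d μ ν ≤ kantorovich e μ ν :=
  le_kantorovich fun ω hω => (kantorovich_le hd hω).trans (transportCost_mono h ω)

theorem kantorovich_self {d : X → X → ℝ} (hd : ∀ x y, 0 ≤ d x y) (h0 : ∀ x, d x x = 0)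
    (μ : stdSimplex ℝ X) : kantorovich d μ μ = 0 := by
  classical
  refine le_antisymm ?_ (kantorovich_nonneg hd μ μ)
  let ω : stdSimplex ℝ (X × X) := ⟨fun p => if p.1 = p.2 then μ p.1 else 0, fun p => by
    dsimp only; split_ifs; exacts [stdSimplex.zero_le _ _, le_rfl], by
    rw [Fintype.sum_prod_type]; simp⟩
  have hω : ω ∈ couplings μ μ := by
    constructor
    · intro y
      change ∑ x, (if x = y then μ x else 0) = μ y
      simp
    · intro x
      change ∑ y, (if x = y then μ x else 0) = μ x
      simp
  refine (kantorovich_le hd hω).trans (le_of_eq ?_)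
  refine Finset.sum_eq_zero fun x _ => Finset.sum_eq_zero fun y _ => ?_
  change d x y * (if x = y then μ x else 0) = 0
  split_ifs with h
  · subst h; simp [h0]
  · simp

theorem kantorovich_le_swap {d : X → X → ℝ} (hd : ∀ x y, 0 ≤ d x y)
    (hs : ∀ x y, d x y = d y x) (μ ν : stdSimplex ℝ X) :
    kantorovich d μ ν ≤ kantorovich d ν μ := by
  refine le_kantorovich fun ω hω => ?_
  let ω' : stdSimplex ℝ (X × X) := ⟨fun p => ω (p.2, p.1), fun p => stdSimplex.zero_le _ _, by
    rw [Fintype.sum_prod_type, Finset.sum_comm, ← Fintype.sum_prod_type']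
    exact stdSimplex.sum_eq_one ω⟩
  have hω' : ω' ∈ couplings μ ν := ⟨hω.2, hω.1⟩
  refine (kantorovich_le hd hω').trans (le_of_eq ?_)
  change ∑ x, ∑ y, d x y * ω (y, x) = ∑ x, ∑ y, d x y * ω (x, y)
  rw [Finset.sum_comm]
  simp only [hs]

theorem kantorovich_triangle {d : X → X → ℝ} (hd : ∀ x y, 0 ≤ d x y)
    (ht : ∀ x y z, d x z ≤ d x y + d y z) (μ ν ρ : stdSimplex ℝ X) :
    kantorovich d μ ρ ≤ kantorovich d μ ν + kantorovich d ν ρ := by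
  suffices H : ∀ ω₁ ∈ couplings μ ν, ∀ ω₂ ∈ couplings ν ρ,
      kantorovich d μ ρ ≤ transportCost d ω₁ + transportCost d ω₂ by
    have h1 : ∀ ω₁ ∈ couplings μ ν,
        kantorovich d μ ρ - transportCost d ω₁ ≤ kantorovich d ν ρ := fun ω₁ h₁ =>
      le_kantorovich fun ω₂ h₂ => by linarith [H ω₁ h₁ ω₂ h₂]
    have h2 : kantorovich d μ ρ - kantorovich d ν ρ ≤ kantorovich d μ ν :=
      le_kantorovich fun ω₁ h₁ => by linarith [h1 ω₁ h₁]
    linarith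
  intro ω₁ h₁ ω₂ h₂
  -- glue the two couplings along their common marginal
  let g : X → X → X → ℝ := fun x y z => ω₁ (x, y) * ω₂ (y, z) / ν y
  have hg : ∀ x y z, 0 ≤ g x y z := fun x y z =>
    div_nonneg (mul_nonneg (stdSimplex.zero_le _ _) (stdSimplex.zero_le _ _))
      (stdSimplex.zero_le _ _)
  have hg1 : ∀ x y, ∑ z, g x y z = ω₁ (x, y) := by
    intro x y
    simp only [g, ← Finset.sum_div, ← Finset.mul_sum, h₂.2 y]
    by_cases hy : ν y = 0
    · have : ω₁ (x, y) = 0 := by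
        have h := h₁.1 y
        rw [hy, Finset.sum_eq_zero_iff_of_nonneg fun _ _ => stdSimplex.zero_le _ _] at h
        exact h x (Finset.mem_univ _)
      simp [this]
    · field_simp
  have hg2 : ∀ y z, ∑ x, g x y z = ω₂ (y, z) := by
    intro y z
    simp only [g, ← Finset.sum_div, ← Finset.sum_mul, h₁.1 y]
    by_cases hy : ν y = 0
    · have : ω₂ (y, z) = 0 := by
        have h := h₂.2 y
        rw [hy, Finset.sum_eq_zero_iff_of_nonneg fun _ _ => stdSimplex.zero_le _ _] at h
        exact h z (Finset.mem_univ _)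
      simp [this]
    · field_simp
  have hx : ∀ x, ∑ z, ∑ y, g x y z = μ x := by
    intro x
    rw [Finset.sum_comm]
    simp only [hg1, h₁.2]
  have hz : ∀ z, ∑ x, ∑ y, g x y z = ρ z := by
    intro z
    rw [Finset.sum_comm]
    simp only [hg2, h₂.1]
  let ω : stdSimplex ℝ (X × X) := ⟨fun p => ∑ y, g p.1 y p.2, fun p =>
    Finset.sum_nonneg fun _ _ => hg _ _ _, by
    rw [Fintype.sum_prod_type]
    simp only [hx, stdSimplex.sum_eq_one]⟩
  have hω : ω ∈ couplings μ ρ := ⟨hz, hx⟩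
  refine (kantorovich_le hd hω).trans ?_
  have e1 : transportCost d ω₁ = ∑ x, ∑ z, ∑ y, d x y * g x y z := by
    refine Finset.sum_congr rfl fun x _ => ?_
    rw [Finset.sum_comm]
    refine Finset.sum_congr rfl fun y _ => ?_
    rw [← Finset.mul_sum, hg1]
  have e2 : transportCost d ω₂ = ∑ x, ∑ z, ∑ y, d y z * g x y z := by
    have : ∀ x, ∑ z, ∑ y, d y z * g x y z = ∑ y, ∑ z, d y z * g x y z :=
      fun x => Finset.sum_comm
    simp only [this]
    rw [Finset.sum_comm]
    refine Finset.sum_congr rfl fun y _ => ?_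
    rw [Finset.sum_comm]
    refine Finset.sum_congr rfl fun z _ => ?_
    rw [← Finset.mul_sum, hg2]
  rw [e1, e2]
  simp only [← Finset.sum_add_distrib]
  refine Finset.sum_le_sum fun x _ => Finset.sum_le_sum fun z _ => ?_
  change d x z * ∑ y, g x y z ≤ _
  rw [Finset.mul_sum]
  refine Finset.sum_le_sum fun y _ => ?_
  rw [← add_mul]
  exact mul_le_mul_of_nonneg_right (ht x y z) (hg x y z)

end Kantorovich

/-! ## The complete lattice of 1-bounded pseudometrics -/

/-- A 1-bounded pseudometric on `X`. -/
structure BoundedPseudometric (X : Type*) where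
  toFun : X → X → ℝ
  nonneg : ∀ x y, 0 ≤ toFun x y
  le_one : ∀ x y, toFun x y ≤ 1
  self : ∀ x, toFun x x = 0
  symm : ∀ x y, toFun x y = toFun y x
  triangle : ∀ x y z, toFun x z ≤ toFun x y + toFun y z

namespace BoundedPseudometric

variable {X : Type*}

instance : CoeFun (BoundedPseudometric X) (fun _ => X → X → ℝ) := ⟨toFun⟩

/-- Pseudometrics are ordered point-wise. -/
instance : PartialOrder (BoundedPseudometric X) where
  le d e := ∀ x y, d x y ≤ e x y
  le_refl _ _ _ := le_rfl
  le_trans _ _ _ h h' x y := (h x y).trans (h' x y)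
  le_antisymm d e h h' := by
    cases d; cases e
    congr 1
    funext x y
    exact le_antisymm (h x y) (h' x y)

theorem bddAbove_values (S : Set (BoundedPseudometric X)) (x y : X) :
    BddAbove ((fun d : BoundedPseudometric X => d x y) '' S) :=
  ⟨1, by rintro _ ⟨d, -, rfl⟩; exact d.le_one x y⟩

theorem values_nonneg (S : Set (BoundedPseudometric X)) (x y : X) :
    0 ≤ sSup ((fun d : BoundedPseudometric X => d x y) '' S) :=
  Real.sSup_nonneg (by rintro _ ⟨d, -, rfl⟩; exact d.nonneg x y)

/-- Suprema are computed point-wise (the supremum of the empty set is the zero pseudometric). -/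
instance : SupSet (BoundedPseudometric X) where
  sSup S :=
    { toFun := fun x y => sSup ((fun d : BoundedPseudometric X => d x y) '' S)
      nonneg := values_nonneg S
      le_one := fun x y => Real.sSup_le (by rintro _ ⟨d, -, rfl⟩; exact d.le_one x y) zero_le_one
      self := fun x => le_antisymm
        (Real.sSup_le (by rintro _ ⟨d, -, rfl⟩; exact (d.self x).le) le_rfl) (values_nonneg S x x)
      symm := fun x y => by
        congr 1
        exact Set.image_congr fun d _ => d.symm x y
      triangle := fun x y z => by
        refine Real.sSup_le ?_ (add_nonneg (values_nonneg S x y) (values_nonneg S y z))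
        rintro _ ⟨d, hd, rfl⟩
        exact (d.triangle x y z).trans (add_le_add
          (le_csSup (bddAbove_values S x y) ⟨d, hd, rfl⟩)
          (le_csSup (bddAbove_values S y z) ⟨d, hd, rfl⟩)) }

/-- The 1-bounded pseudometrics on `X`, ordered point-wise, form a complete lattice. -/
instance : CompleteLattice (BoundedPseudometric X) :=
  completeLatticeOfSup _ fun S =>
    ⟨fun d hd x y => le_csSup (bddAbove_values S x y) ⟨d, hd, rfl⟩,
      fun e he x y => Real.sSup_le (by rintro _ ⟨d, hd, rfl⟩; exact he hd x y) (e.nonneg x y)⟩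

end BoundedPseudometric

/-! ## Markov chains -/

/-- A Markov chain with labels in `L`: a finite nonempty set of states, a transition distribution
for every state, and a labelling of the states. A finite set of states can always be renamed to live
in `Type`. -/
structure MarkovChain (L : Type*) where
  State : Type
  [fintypeState : Fintype State]
  [nonemptyState : Nonempty State]
  trans : State → stdSimplex ℝ State
  label : State → L

attribute [instance] MarkovChain.fintypeState MarkovChain.nonemptyState

/-- A Markov chain together with an initial state. -/
structure PointedMarkovChain (L : Type*) extends MarkovChain L where
  init : State

/-- All transition probabilities are rational numbers. -/
def MarkovChain.IsRational {L : Type*} (M : MarkovChain L) : Prop :=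
  ∀ m n : M.State, ∃ q : ℚ, M.trans m n = (q : ℝ)

/-- A distribution on `X`, regarded as a distribution on the disjoint union `X ⊕ Y`. -/
def inlDist {X Y : Type*} [Fintype X] [Fintype Y] (μ : stdSimplex ℝ X) : stdSimplex ℝ (X ⊕ Y) :=
  ⟨Sum.elim (fun x => μ x) (fun _ => 0), by rintro (x | y) <;> simp, by simp⟩

/-- A distribution on `Y`, regarded as a distribution on the disjoint union `X ⊕ Y`. -/
def inrDist {X Y : Type*} [Fintype X] [Fintype Y] (ν : stdSimplex ℝ Y) : stdSimplex ℝ (X ⊕ Y) :=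
  ⟨Sum.elim (fun _ => 0) (fun y => ν y), by rintro (x | y) <;> simp, by simp⟩

/-- The disjoint union of two Markov chains. -/
def MarkovChain.disjointUnion {L : Type*} (M N : MarkovChain L) : MarkovChain L where
  State := M.State ⊕ N.State
  trans := Sum.elim (fun m => inlDist (M.trans m)) (fun n => inrDist (N.trans n))
  label := Sum.elim M.label N.label

/-! ## The bisimilarity distance -/

section Bisimilarity

variable {L : Type*}

open Classical in
/-- The functional whose least fixed point is the bisimilarity distance: states with different
labels are at distance `1`; otherwise the distance is `lam` times the Kantorovich distance of the
transition distributions. -/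
def bisimFun (lam : Set.Ioc (0 : ℝ) 1) (M : MarkovChain L) (d : M.State → M.State → ℝ)
    (m n : M.State) : ℝ :=
  if M.label m ≠ M.label n then 1 else lam * kantorovich d (M.trans m) (M.trans n)

/-- The functional, as a monotone map on the lattice of 1-bounded pseudometrics. -/
def bisimOperator (lam : Set.Ioc (0 : ℝ) 1) (M : MarkovChain L) :
    BoundedPseudometric M.State →o BoundedPseudometric M.State where
  toFun d :=
    have hl0 : 0 ≤ (lam : ℝ) := lam.2.1.le
    have h0 : ∀ m n, 0 ≤ bisimFun lam M d m n := fun m n => by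
      unfold bisimFun
      split_ifs
      exacts [zero_le_one, mul_nonneg hl0 (kantorovich_nonneg d.nonneg _ _)]
    have h1 : ∀ m n, bisimFun lam M d m n ≤ 1 := fun m n => by
      unfold bisimFun
      split_ifs
      exacts [le_rfl, mul_le_one₀ lam.2.2 (kantorovich_nonneg d.nonneg _ _)
        (kantorovich_le_one d.nonneg d.le_one _ _)]
    { toFun := bisimFun lam M d
      nonneg := h0
      le_one := h1
      self := fun m => by simp [bisimFun, kantorovich_self d.nonneg d.self]
      symm := fun m n => by
        have hk : kantorovich d (M.trans m) (M.trans n) = kantorovich d (M.trans n) (M.trans m) :=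
          le_antisymm (kantorovich_le_swap d.nonneg d.symm _ _)
            (kantorovich_le_swap d.nonneg d.symm _ _)
        by_cases h : M.label m = M.label n
        · simp [bisimFun, h, hk]
        · simp [bisimFun, h, Ne.symm h]
      triangle := fun x y z => by
        by_cases hxy : M.label x = M.label y
        · by_cases hyz : M.label y = M.label z
          · simp only [bisimFun, hxy, hyz, ne_eq, not_true_eq_false, if_false, ← mul_add]
            exact mul_le_mul_of_nonneg_left
              (kantorovich_triangle d.nonneg d.triangle _ _ _) hl0
          · have : bisimFun lam M d y z = 1 := by simp [bisimFun, hyz]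
            linarith [h0 x y, h1 x z]
        · have : bisimFun lam M d x y = 1 := by simp [bisimFun, hxy]
          linarith [h0 y z, h1 x z] }
  monotone' d e h m n := by
    change bisimFun lam M d m n ≤ bisimFun lam M e m n
    unfold bisimFun
    split_ifs
    exacts [le_rfl, mul_le_mul_of_nonneg_left (kantorovich_mono d.nonneg h _ _) lam.2.1.le]

/-- The `lam`-discounted bisimilarity pseudometric on the states of `M`: the least fixed point of
the functional on 1-bounded pseudometrics. -/
def bisimDist (lam : Set.Ioc (0 : ℝ) 1) (M : MarkovChain L) : BoundedPseudometric M.State :=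
  (bisimOperator lam M).lfp

/-- The `lam`-discounted distance between two Markov chains with initial states: the distance of
the initial states in the disjoint union. -/
def chainDist (lam : Set.Ioc (0 : ℝ) 1) (M N : PointedMarkovChain L) : ℝ :=
  bisimDist lam (M.toMarkovChain.disjointUnion N.toMarkovChain) (Sum.inl M.init) (Sum.inr N.init)

/-- The discount factor `1`, giving the undiscounted distance. -/
def undiscounted : Set.Ioc (0 : ℝ) 1 := ⟨1, zero_lt_one, le_rfl⟩

/-- `N` is a closest `k`-bounded approximant of `M`: it has at most `k` states, and its distance to
`M` is minimal among all Markov chains with at most `k` states. -/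
def IsClosestApproximant (lam : Set.Ioc (0 : ℝ) 1) (M : PointedMarkovChain L) (k : ℕ)
    (N : PointedMarkovChain L) : Prop :=
  Fintype.card N.State ≤ k ∧
    ∀ N' : PointedMarkovChain L, Fintype.card N'.State ≤ k →
      chainDist lam M N ≤ chainDist lam M N'

end Bisimilarity

/-! ## The two chains of the example -/

section Example

variable {L : Type*}

/-- The five-state chain: `m₀ → m₁ → m₂ → m₃` with probability `79/100` in each step, from each of
`m₀, m₁, m₂` to `m₄` with probability `21/100`, and `m₃`, `m₄` absorbing. The states `m₀, m₁, m₂`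
are red, `m₃` is blue and `m₄` is green; `m₀` is initial. -/
def exampleM (red blue green : L) : PointedMarkovChain L where
  State := Fin 5
  trans i := ⟨(!![0, 79/100, 0, 0, 21/100;
                  0, 0, 79/100, 0, 21/100;
                  0, 0, 0, 79/100, 21/100;
                  0, 0, 0, 1, 0;
                  0, 0, 0, 0, 1] : Matrix (Fin 5) (Fin 5) ℝ) i, by
    constructor
    · intro j
      fin_cases i <;> fin_cases j <;> norm_num
    · fin_cases i <;> norm_num [Fin.sum_univ_succ]⟩
  label := ![red, red, red, blue, green]
  init := 0

/-- The three-state chain with parameters `x, y`: from the red initial state `n₀`, loop with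
probability `x`, go to the blue absorbing state `n₁` with probability `1 - x - y` and to the green
absorbing state `n₂` with probability `y`. -/
def exampleN (red blue green : L) (x y : ℝ) (h : 0 ≤ x ∧ 0 ≤ y ∧ x + y ≤ 1) :
    PointedMarkovChain L where
  State := Fin 3
  trans i := ⟨(!![x, 1 - x - y, y;
                  0, 1, 0;
                  0, 0, 1] : Matrix (Fin 3) (Fin 3) ℝ) i, by
    obtain ⟨hx, hy, hxy⟩ := h
    constructor
    · intro j
      fin_cases i <;> fin_cases j <;> norm_num <;> linarith
    · fin_cases i <;> norm_num [Fin.sum_univ_succ]⟩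
  label := ![red, blue, green]
  init := 0

end Example

end

end MarkovApprox

/-! Work with the similarity `1 - δ₁`, which the fixed-point equation makes the maximal expected
similarity of successors over couplings. Suppose a competitor has exactly one state of each colour,
and its red initial state moves to red, blue, green with probabilities `x`, `b`, `y`. The red states
of the long chain can resemble only that red state, so a coupling collects at most the minimum of
the two masses on each useful pair (`crossSim_le_of_unique`). Unrolling three steps bounds the
similarity by `((b + y) * x + y) * x + y`, with each variable truncated at the mass available in the
long chain.

This is largest for `y = 21/100` and `x + y + b = 1`, where it becomes the cubic `-x³ + x² + 21/100
* x + 21/100`. Its derivative vanishes at the positive root of `3x² - 2x - 21/100`, which is `(10 +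
√163) / 30`. The gap to the maximum is a square times a positive factor (`one_sub_cubic_eq`), so
equality forces this irrational loop probability.

Competitors lacking a colour are excluded numerically, and a non-red initial state gives similarity
`0` (`optDist_le`). An explicit coupling shows that the bound is attained (`chainDist_exampleN_le`).
-/

namespace MarkovApprox

open Finset

/-! ### Couplings across a disjoint union, and between point masses -/

section Kantorovich

variable {X Y : Type*} [Fintype X] [Fintype Y]

/-- The marginals vanish off the left and right summand respectively, so nonnegativity confines
every coupling to the block `X × Y`. Lower bounds need only be tested on matrices indexed by that
block. -/
theorem le_kantorovich_inl_inr {d : X ⊕ Y → X ⊕ Y → ℝ} (μ : stdSimplex ℝ X) (ν : stdSimplex ℝ Y)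
    {c : ℝ}
    (h : ∀ w : X → Y → ℝ, (∀ x y, 0 ≤ w x y) → (∀ x, ∑ y, w x y = μ x) →
      (∀ y, ∑ x, w x y = ν y) → c ≤ ∑ x, ∑ y, d (Sum.inl x) (Sum.inr y) * w x y) :
    c ≤ kantorovich d (inlDist μ) (inrDist ν) := by
  refine le_kantorovich fun ω hω => ?_
  obtain ⟨hcol, hrow⟩ := hω
  have hnn : ∀ p, 0 ≤ ω p := fun p => stdSimplex.zero_le _ _
  have hr : ∀ y v, ω (Sum.inr y, v) = 0 := fun y v => by
    have h0 : ∑ v, ω (Sum.inr y, v) = 0 := hrow (Sum.inr y)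
    exact (sum_eq_zero_iff_of_nonneg fun _ _ => hnn _).1 h0 v (mem_univ _)
  have hl : ∀ u x, ω (u, Sum.inl x) = 0 := fun u x => by
    have h0 : ∑ u, ω (u, Sum.inl x) = 0 := hcol (Sum.inl x)
    exact (sum_eq_zero_iff_of_nonneg fun _ _ => hnn _).1 h0 u (mem_univ _)
  refine (h (fun x y => ω (Sum.inl x, Sum.inr y)) (fun _ _ => hnn _) (fun x => ?_)
    (fun y => ?_)).trans (le_of_eq ?_)
  · have h0 : ∑ v, ω (Sum.inl x, v) = μ x := hrow (Sum.inl x)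
    simpa [Fintype.sum_sum_type, hl] using h0
  · have h0 : ∑ u, ω (u, Sum.inr y) = ν y := hcol (Sum.inr y)
    simpa [Fintype.sum_sum_type, hr] using h0
  · simp [transportCost, Fintype.sum_sum_type, hl, hr]

theorem kantorovich_inl_inr_le {d : X ⊕ Y → X ⊕ Y → ℝ} (hd : ∀ u v, 0 ≤ d u v)
    {μ : stdSimplex ℝ X} {ν : stdSimplex ℝ Y} (w : X → Y → ℝ) (hw : ∀ x y, 0 ≤ w x y)
    (hrow : ∀ x, ∑ y, w x y = μ x) (hcol : ∀ y, ∑ x, w x y = ν y) :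
    kantorovich d (inlDist μ) (inrDist ν) ≤ ∑ x, ∑ y, d (Sum.inl x) (Sum.inr y) * w x y := by
  let f : (X ⊕ Y) × (X ⊕ Y) → ℝ := fun p =>
    Sum.elim (fun x => Sum.elim (fun _ => 0) (fun y => w x y) p.2) (fun _ => 0) p.1
  let ω : stdSimplex ℝ ((X ⊕ Y) × (X ⊕ Y)) := ⟨f, by
    rintro ⟨x | y, x' | y'⟩ <;> simp [f, hw], by
    rw [Fintype.sum_prod_type]
    simp [f, Fintype.sum_sum_type, hrow]⟩
  have hω : ω ∈ couplings (inlDist μ) (inrDist ν) := by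
    constructor
    · rintro (x | y)
      · change ∑ u, f (u, Sum.inl x) = 0
        simp [f]
      · change ∑ u, f (u, Sum.inr y) = ν y
        simp [f, Fintype.sum_sum_type, hcol]
    · rintro (x | y)
      · change ∑ u, f (Sum.inl x, u) = μ x
        simp [f, Fintype.sum_sum_type, hrow]
      · change ∑ u, f (Sum.inr y, u) = 0
        simp [f]
  refine (kantorovich_le hd hω).trans (le_of_eq ?_)
  change ∑ u, ∑ v, d u v * f (u, v) = _
  simp [f, Fintype.sum_sum_type]

theorem kantorovich_le_of_eq_one {d : X → X → ℝ} (hd : ∀ u v, 0 ≤ d u v) {μ ν : stdSimplex ℝ X}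
    {a b : X} (ha : μ a = 1) (hb : ν b = 1) : kantorovich d μ ν ≤ d a b := by
  have key : ∀ (ρ : stdSimplex ℝ X) (c : X), ρ c = 1 → ∀ u, u ≠ c → ρ u = 0 := by
    classical
    intro ρ c hc u hu
    have h1 := stdSimplex.sum_eq_one ρ
    rw [← add_sum_erase _ _ (mem_univ c), hc] at h1
    have h2 : ∑ x ∈ univ.erase c, ρ x = 0 := by linarith
    exact (sum_eq_zero_iff_of_nonneg fun _ _ => stdSimplex.zero_le _ _).1 h2 u
      (mem_erase.2 ⟨hu, mem_univ _⟩)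
  let ω : stdSimplex ℝ (X × X) := ⟨fun p => μ p.1 * ν p.2, fun p => mul_nonneg
    (stdSimplex.zero_le _ _) (stdSimplex.zero_le _ _), by
    rw [Fintype.sum_prod_type]
    simp [← mul_sum]⟩
  have hω : ω ∈ couplings μ ν := by
    constructor
    · intro y
      change ∑ x, μ x * ν y = ν y
      simp [← sum_mul]
    · intro x
      change ∑ y, μ x * ν y = μ x
      simp [← mul_sum]
  refine (kantorovich_le hd hω).trans (le_of_eq ?_)
  change ∑ u, ∑ v, d u v * (μ u * ν v) = d a b
  rw [sum_eq_single a, sum_eq_single b]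
  · simp [ha, hb]
  · intro v _ hv
    simp [key ν b hb v hv]
  · simp
  · intro u _ hu
    simp [key μ a ha u hu]
  · simp

end Kantorovich

/-! ### The fixed-point equation in terms of similarity -/

section Bisimilarity

variable {L : Type*}

theorem bisimFun_bisimDist (lam : Set.Ioc (0 : ℝ) 1) (M : MarkovChain L) (u v : M.State) :
    bisimFun lam M (bisimDist lam M) u v = bisimDist lam M u v :=
  congrArg (fun d : BoundedPseudometric M.State => d u v) (bisimOperator lam M).map_lfp

theorem bisimDist_eq_one_of_label_ne (lam : Set.Ioc (0 : ℝ) 1) (M : MarkovChain L) {u v : M.State}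
    (h : M.label u ≠ M.label v) : bisimDist lam M u v = 1 := by
  rw [← bisimFun_bisimDist, bisimFun, if_pos h]

theorem bisimDist_undiscounted (M : MarkovChain L) {u v : M.State} (h : M.label u = M.label v) :
    bisimDist undiscounted M u v =
      kantorovich (bisimDist undiscounted M) (M.trans u) (M.trans v) := by
  rw [← bisimFun_bisimDist, bisimFun, if_neg (not_not.2 h)]
  simp [undiscounted]

/-- Absorbing states with equal labels are at distance `0`. -/
theorem bisimDist_eq_zero_of_absorbing (lam : Set.Ioc (0 : ℝ) 1) (M : MarkovChain L)
    {u v : M.State} (hl : M.label u = M.label v) (hu : M.trans u u = 1) (hv : M.trans v v = 1) :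
    bisimDist lam M u v = 0 := by
  classical
  -- Leastness is essential here: with discount `1` the fixed-point equation at two absorbing states
  -- only says that their distance equals itself. The `0`/`1` pseudometric of this equivalence
  -- relation is a pre-fixed point, hence an upper bound for the least one.
  let r : M.State → M.State → Prop := fun a b =>
    a = b ∨ (M.label a = M.label b ∧ M.trans a a = 1 ∧ M.trans b b = 1)
  have rsymm : ∀ a b, r a b → r b a := by
    rintro a b (h | ⟨h1, h2, h3⟩)
    exacts [Or.inl h.symm, Or.inr ⟨h1.symm, h3, h2⟩]
  have rtrans : ∀ a b c, r a b → r b c → r a c := by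
    rintro a b c (rfl | ⟨h1, h2, h3⟩) (rfl | ⟨h4, h5, h6⟩)
    exacts [Or.inl rfl, Or.inr ⟨h4, h5, h6⟩, Or.inr ⟨h1, h2, h3⟩, Or.inr ⟨h1.trans h4, h2, h6⟩]
  let e : BoundedPseudometric M.State :=
    { toFun := fun a b => if r a b then 0 else 1
      nonneg := fun a b => by split_ifs <;> norm_num
      le_one := fun a b => by split_ifs <;> norm_num
      self := fun a => if_pos (Or.inl rfl)
      symm := fun a b => by simp only [show r a b ↔ r b a from ⟨rsymm a b, rsymm b a⟩]
      triangle := fun a b c => by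
        by_cases h1 : r a b
        · by_cases h2 : r b c
          · simp [h1, h2, rtrans a b c h1 h2]
          · simp only [h1, h2, if_true, if_false]
            split_ifs <;> norm_num
        · simp only [h1, if_false]
          split_ifs <;> norm_num }
  have he : bisimOperator lam M e ≤ e := by
    intro a b
    by_cases h : r a b
    · have e0 : e a b = 0 := if_pos h
      rcases h with rfl | ⟨h1, h2, h3⟩
      · rw [(bisimOperator lam M e).self, e.self]
      · change bisimFun lam M e a b ≤ e a b
        rw [bisimFun, if_neg (not_not.2 h1), e0]
        exact mul_nonpos_of_nonneg_of_nonpos lam.2.1.le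
          ((kantorovich_le_of_eq_one e.nonneg h2 h3).trans e0.le)
    · have e1 : e a b = 1 := if_neg h
      rw [e1]
      exact (bisimOperator lam M e).le_one a b
  have h0 : bisimDist lam M u v ≤ e u v := (bisimOperator lam M).lfp_le he u v
  have e0 : e u v = 0 := if_pos (Or.inr ⟨hl, hu, hv⟩)
  exact le_antisymm (h0.trans e0.le) ((bisimDist lam M).nonneg u v)

/-- The undiscounted bisimilarity similarity `1 - δ₁` of a state of `M` and a state of `N`. -/
noncomputable def crossSim (M N : MarkovChain L) (m : M.State) (n : N.State) : ℝ :=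
  1 - bisimDist undiscounted (M.disjointUnion N) (Sum.inl m) (Sum.inr n)

theorem crossSim_nonneg (M N : MarkovChain L) (m : M.State) (n : N.State) :
    0 ≤ crossSim M N m n :=
  sub_nonneg.2 ((bisimDist undiscounted (M.disjointUnion N)).le_one _ _)

theorem crossSim_le_one (M N : MarkovChain L) (m : M.State) (n : N.State) :
    crossSim M N m n ≤ 1 :=
  sub_le_self _ ((bisimDist undiscounted (M.disjointUnion N)).nonneg _ _)

theorem crossSim_eq_zero (M N : MarkovChain L) {m : M.State} {n : N.State}
    (h : M.label m ≠ N.label n) : crossSim M N m n = 0 := by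
  rw [crossSim, bisimDist_eq_one_of_label_ne undiscounted (M.disjointUnion N)
    (u := Sum.inl m) (v := Sum.inr n) h, sub_self]

theorem crossSim_eq_one (M N : MarkovChain L) {m : M.State} {n : N.State}
    (h : M.label m = N.label n) (hm : M.trans m m = 1) (hn : N.trans n n = 1) :
    crossSim M N m n = 1 := by
  rw [crossSim, bisimDist_eq_zero_of_absorbing undiscounted (M.disjointUnion N)
    (u := Sum.inl m) (v := Sum.inr n) h hm hn, sub_zero]

/-- Couplings have total mass `1`, so the expected similarity is `1` minus the transport cost, and
the minimum over couplings becomes a maximum. The hypothesis `0 ≤ c` covers states with different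
labels. -/
theorem crossSim_le (M N : MarkovChain L) {m : M.State} {n : N.State} {c : ℝ} (hc : 0 ≤ c)
    (h : ∀ w : M.State → N.State → ℝ, (∀ x y, 0 ≤ w x y) → (∀ x, ∑ y, w x y = M.trans m x) →
      (∀ y, ∑ x, w x y = N.trans n y) → ∑ x, ∑ y, crossSim M N x y * w x y ≤ c) :
    crossSim M N m n ≤ c := by
  by_cases hl : M.label m = N.label n
  · have key : 1 - c ≤ kantorovich (bisimDist undiscounted (M.disjointUnion N))
        (inlDist (M.trans m)) (inrDist (N.trans n)) := by
      refine le_kantorovich_inl_inr _ _ fun w hw hr hcol => ?_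
      have h1 := h w hw hr hcol
      have h2 : ∑ x, ∑ y, w x y = 1 := by simp [hr]
      simp only [crossSim, sub_mul, one_mul, sum_sub_distrib, h2] at h1
      linarith
    have h3 := bisimDist_undiscounted (M.disjointUnion N) (u := Sum.inl m) (v := Sum.inr n) hl
    have h4 : 1 - c ≤ bisimDist undiscounted (M.disjointUnion N) (Sum.inl m) (Sum.inr n) :=
      h3 ▸ key
    rw [crossSim]
    linarith
  · rw [crossSim_eq_zero M N hl]
    exact hc

theorem le_crossSim (M N : MarkovChain L) {m : M.State} {n : N.State}
    (hl : M.label m = N.label n) (w : M.State → N.State → ℝ) (hw : ∀ x y, 0 ≤ w x y)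
    (hr : ∀ x, ∑ y, w x y = M.trans m x) (hcol : ∀ y, ∑ x, w x y = N.trans n y) :
    ∑ x, ∑ y, crossSim M N x y * w x y ≤ crossSim M N m n := by
  have h1 := kantorovich_inl_inr_le (bisimDist undiscounted (M.disjointUnion N)).nonneg
    w hw hr hcol
  have h2 : ∑ x, ∑ y, w x y = 1 := by simp [hr]
  have h3 := bisimDist_undiscounted (M.disjointUnion N) (u := Sum.inl m) (v := Sum.inr n) hl
  have h4 := h3.le.trans h1
  simp only [crossSim, sub_mul, one_mul, sum_sub_distrib, h2]
  linarith

/-- The similarity bound for a state `m` all of whose successors are among `j` and `k`. -/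
theorem crossSim_le_of_two_successors (M N : MarkovChain L) {m j k : M.State} {n : N.State}
    (hjk : j ≠ k) (hsupp : ∀ x, x ≠ j → x ≠ k → M.trans m x = 0) {c : ℝ} (hc : 0 ≤ c)
    (h : ∀ v w : N.State → ℝ, (∀ y, 0 ≤ v y) → (∀ y, 0 ≤ w y) → ∑ y, v y = M.trans m j →
      ∑ y, w y = M.trans m k → (∀ y, v y + w y = N.trans n y) →
      ∑ y, crossSim M N j y * v y + ∑ y, crossSim M N k y * w y ≤ c) :
    crossSim M N m n ≤ c := by
  classical
  refine crossSim_le M N hc fun w hw hr hcol => ?_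
  have h0 : ∀ x, x ≠ j → x ≠ k → ∀ y, w x y = 0 := fun x hj hk y =>
    (sum_eq_zero_iff_of_nonneg fun _ _ => hw _ _).1 ((hr x).trans (hsupp x hj hk)) y (mem_univ _)
  have split : ∀ f : M.State → ℝ, (∀ x, x ≠ j → x ≠ k → f x = 0) → ∑ x, f x = f j + f k :=
    fun f hf => Fintype.sum_eq_add j k hjk fun x hx => hf x hx.1 hx.2
  rw [split _ fun x hj hk => sum_eq_zero fun y _ => by rw [h0 x hj hk, mul_zero]]
  refine h (w j) (w k) (hw j) (hw k) (hr j) (hr k) fun y => ?_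
  rw [← hcol, split _ fun x hj hk => h0 x hj hk y]

/-- This bound uses nothing about the transitions of `N`; it serves for chains in which a colour is
missing. -/
theorem crossSim_le_of_forall_le (M N : MarkovChain L) {m j k : M.State} {n : N.State}
    (hjk : j ≠ k) (hsupp : ∀ x, x ≠ j → x ≠ k → M.trans m x = 0) {s t : ℝ}
    (hs : ∀ y, crossSim M N j y ≤ s) (ht : ∀ y, crossSim M N k y ≤ t) :
    crossSim M N m n ≤ s * M.trans m j + t * M.trans m k := by
  have hs0 : 0 ≤ s := (crossSim_nonneg M N j n).trans (hs n)
  have ht0 : 0 ≤ t := (crossSim_nonneg M N k n).trans (ht n)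
  refine crossSim_le_of_two_successors M N hjk hsupp
    (add_nonneg (mul_nonneg hs0 (stdSimplex.zero_le _ _))
      (mul_nonneg ht0 (stdSimplex.zero_le _ _))) fun v w hv hw hvs hws _ => ?_
  rw [← hvs, ← hws, mul_sum, mul_sum]
  exact add_le_add (sum_le_sum fun y _ => mul_le_mul_of_nonneg_right (hs y) (hv y))
    (sum_le_sum fun y _ => mul_le_mul_of_nonneg_right (ht y) (hw y))

/-- Only the pairs `(j, p)` and `(k, q)` can contribute, and a coupling puts no more mass on a pair
than either marginal allows. -/
theorem crossSim_le_of_unique (M N : MarkovChain L) {m j k : M.State} {n p q : N.State}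
    (hjk : j ≠ k) (hsupp : ∀ x, x ≠ j → x ≠ k → M.trans m x = 0) {s : ℝ}
    (hj : ∀ y, y ≠ p → crossSim M N j y = 0) (hs : crossSim M N j p ≤ s)
    (hk : ∀ y, y ≠ q → crossSim M N k y = 0) :
    crossSim M N m n ≤
      s * min (M.trans m j) (N.trans n p) + min (M.trans m k) (N.trans n q) := by
  have hs0 : 0 ≤ s := (crossSim_nonneg M N j p).trans hs
  have hmin : ∀ x y, 0 ≤ min (M.trans m x) (N.trans n y) := fun x y =>
    le_min (stdSimplex.zero_le _ _) (stdSimplex.zero_le _ _)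
  refine crossSim_le_of_two_successors M N hjk hsupp
    (add_nonneg (mul_nonneg hs0 (hmin _ _)) (hmin _ _)) fun v w hv hw hvs hws hvw => ?_
  rw [Fintype.sum_eq_single p fun y hy => by rw [hj y hy, zero_mul],
    Fintype.sum_eq_single q fun y hy => by rw [hk y hy, zero_mul]]
  have hvp : v p ≤ min (M.trans m j) (N.trans n p) :=
    le_min (hvs ▸ single_le_sum (fun y _ => hv y) (mem_univ p)) (by linarith [hvw p, hw p])
  have hwq : w q ≤ min (M.trans m k) (N.trans n q) :=
    le_min (hws ▸ single_le_sum (fun y _ => hw y) (mem_univ q)) (by linarith [hvw q, hv q])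
  refine add_le_add (mul_le_mul hs hvp (hv p) hs0) ?_
  calc crossSim M N k q * w q ≤ 1 * w q :=
        mul_le_mul_of_nonneg_right (crossSim_le_one M N k q) (hw q)
    _ ≤ _ := by rwa [one_mul]

theorem chainDist_eq (M N : PointedMarkovChain L) :
    chainDist undiscounted M N =
      1 - crossSim M.toMarkovChain N.toMarkovChain M.init N.init := by
  rw [crossSim, sub_sub_cancel]
  rfl

end Bisimilarity

/-! ### The five-state chain and its three-state approximants -/

section Example

variable {L : Type*} {red blue green : L}

theorem exampleM_isRational : (exampleM red blue green).IsRational := by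
  intro m n
  change ∃ q : ℚ, (!![0, 79/100, 0, 0, 21/100; 0, 0, 79/100, 0, 21/100;
    0, 0, 0, 79/100, 21/100; 0, 0, 0, 1, 0; 0, 0, 0, 0, 1] : Matrix (Fin 5) (Fin 5) ℝ) m n = q
  refine ⟨(!![0, 79/100, 0, 0, 21/100; 0, 0, 79/100, 0, 21/100;
    0, 0, 0, 79/100, 21/100; 0, 0, 0, 1, 0; 0, 0, 0, 0, 1] : Matrix (Fin 5) (Fin 5) ℚ) m n, ?_⟩
  change Fin 5 at m n
  fin_cases m <;> fin_cases n <;> norm_num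

/-- Writing the red states as `Fin.castLE _ i` and their non-green successors as `Fin.castLE _
i.succ`, for `i : Fin 3`, lets one argument handle all three red states. -/
theorem castLE_succ_ne_four : ∀ i : Fin 3, (Fin.castLE (by norm_num) i.succ : Fin 5) ≠ 4 := by
  decide

/-- The successors of a red state of the five-state chain. -/
theorem exampleM_trans_red (i : Fin 3) :
    (exampleM red blue green).trans (Fin.castLE (by norm_num) i : Fin 5)
        (Fin.castLE (by norm_num) i.succ : Fin 5) = 79 / 100 ∧
      (exampleM red blue green).trans (Fin.castLE (by norm_num) i : Fin 5) (4 : Fin 5)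
        = 21 / 100 ∧
      ∀ x : Fin 5, x ≠ (Fin.castLE (by norm_num) i.succ : Fin 5) → x ≠ 4 →
        (exampleM red blue green).trans (Fin.castLE (by norm_num) i : Fin 5) x = 0 := by
  refine ⟨?_, ?_, fun x h1 h2 => ?_⟩
  · fin_cases i <;> rfl
  · fin_cases i <;> rfl
  · fin_cases i <;> fin_cases x <;> first | rfl | exact absurd rfl h1 | exact absurd rfl h2

/-- The optimal loop probability. -/
noncomputable def optLoop : ℝ := (1 / 30) * (10 + Real.sqrt 163)

theorem sqrt_163_bounds : (12.76 : ℝ) < √163 ∧ √163 < 12.77 := by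
  constructor
  · exact Real.lt_sqrt_of_sq_lt (by norm_num)
  · exact (Real.sqrt_lt' (by norm_num)).2 (by norm_num)

theorem optLoop_bounds : 0.75 < optLoop ∧ optLoop < 0.76 := by
  have := sqrt_163_bounds
  constructor <;> (unfold optLoop; linarith)

theorem irrational_sqrt_163 : Irrational (√163 : ℝ) := by
  have h : Nat.Prime 163 := by norm_num
  exact_mod_cast h.irrational_sqrt

theorem irrational_optLoop : Irrational optLoop := by
  rintro ⟨q, hq⟩
  refine irrational_sqrt_163 ⟨30 * q - 10, ?_⟩
  push_cast
  rw [hq, optLoop]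
  ring

theorem irrational_optDist : Irrational (436 / 675 - 163 * √163 / 13500) := by
  rintro ⟨q, hq⟩
  refine irrational_sqrt_163 ⟨(436 / 675 - q) * 13500 / 163, ?_⟩
  push_cast
  rw [hq]
  ring

/-- The maximum minus the cubic is monic in `x` with a double root at the critical point `optLoop`.
The roots sum to `1`, so the third is `1 - 2 * optLoop`; it is negative, which makes the last factor
positive for `x ≥ 0`. -/
theorem one_sub_cubic_eq (x : ℝ) :
    1 - (436 / 675 - 163 * √163 / 13500) - (x * (x * (79 / 100 - x + 21 / 100) + 21 / 100) +
      21 / 100) = (x - optLoop) ^ 2 * (x + 2 * optLoop - 1) := by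
  have h : (√163 : ℝ) ^ 2 = 163 := Real.sq_sqrt (by norm_num)
  have h3 : (√163 : ℝ) ^ 3 = 163 * √163 := by rw [pow_succ, h]
  unfold optLoop
  ring_nf
  rw [h3, h]
  ring

/-- The left side is `(b + y) * x² + y * x + y`. Replacing `b + y` by `1 - x` and the remaining `y`
by `21/100` only increases it and gives the cubic. -/
theorem sim_le_opt {x y b : ℝ} (hx : 0 ≤ x) (hy : y ≤ 21 / 100) (h : x + y + b ≤ 1) :
    ((b + y) * x + y) * x + y ≤ 1 - (436 / 675 - 163 * √163 / 13500) -
      (x - optLoop) ^ 2 * (x + 2 * optLoop - 1) := by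
  rw [← one_sub_cubic_eq]
  nlinarith [mul_nonneg (sq_nonneg x) (sub_nonneg.2 h), mul_nonneg hx (sub_nonneg.2 hy)]

/-- Every chain with at most three states is at least the optimal distance away from the five-state
chain, with equality only if its initial state has the optimal loop probability. -/
theorem optDist_le (hrb : red ≠ blue) (hrg : red ≠ green) (hbg : blue ≠ green)
    (N : PointedMarkovChain L) (hN : Fintype.card N.State ≤ 3) :
    436 / 675 - 163 * √163 / 13500 ≤ chainDist undiscounted (exampleM red blue green) N ∧
      (chainDist undiscounted (exampleM red blue green) N ≤ 436 / 675 - 163 * √163 / 13500 →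
        N.trans N.init N.init = optLoop) := by
  classical
  have hsq := sqrt_163_bounds
  have hopt := optLoop_bounds
  rw [chainDist_eq]
  set M := exampleM red blue green
  let S : Fin 5 → N.State → ℝ := crossSim M.toMarkovChain N.toMarkovChain
  change _ ≤ 1 - S 0 N.init ∧ (1 - S 0 N.init ≤ _ → _)
  -- Back-propagation through `m₂`, `m₁`, `m₀` of uniform bounds `s` and `t` on the similarities of
  -- the blue and green states.
  have crude : ∀ s t : ℝ, (∀ y, S 3 y ≤ s) → (∀ y, S 4 y ≤ t) → ∀ y,
      S 0 y ≤ ((s * (79 / 100) + t * (21 / 100)) * (79 / 100) + t * (21 / 100)) * (79 / 100)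
        + t * (21 / 100) := by
    intro s t h3 h4
    have step : ∀ (i : Fin 3) (s : ℝ), (∀ y, S (Fin.castLE (by norm_num) i.succ) y ≤ s) →
        ∀ y, S (Fin.castLE (by norm_num) i) y ≤ s * (79 / 100) + t * (21 / 100) := by
      intro i s hs y
      obtain ⟨h1, h2, h0⟩ := exampleM_trans_red (red := red) (blue := blue) (green := green) i
      have := crossSim_le_of_forall_le M.toMarkovChain N.toMarkovChain (n := y)
        (m := (Fin.castLE (by norm_num) i : Fin 5))
        (j := (Fin.castLE (by norm_num) i.succ : Fin 5)) (k := (4 : Fin 5))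
        (castLE_succ_ne_four i) h0 hs h4
      rwa [h1, h2] at this
    exact step 0 _ (step 1 _ (step 2 _ h3))
  have zero : ∀ {i : Fin 5} {y : N.State}, M.label i ≠ N.label y → S i y = 0 := fun h =>
    crossSim_eq_zero M.toMarkovChain N.toMarkovChain h
  have one : ∀ i y, S i y ≤ 1 := crossSim_le_one M.toMarkovChain N.toMarkovChain
  by_cases hg : ∃ g, N.label g = green
  swap
  -- Without green the similarity is at most `(79/100)³ < 0.494`, below the optimum of about
  -- `0.508`; the equality clause is then vacuous.
  · have := crude 1 0 (one 3)
      (fun y => (zero (i := 4) fun h => hg ⟨y, h.symm⟩).le) N.init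
    constructor <;> intros <;> linarith
  by_cases hb : ∃ b, N.label b = blue
  swap
  -- Without blue the bound is `1 - (79/100)³ < 0.507`, still below `0.508`, though narrowly.
  · have := crude 0 1 (fun y => (zero (i := 3) fun h => hb ⟨y, h.symm⟩).le) (one 4) N.init
    constructor <;> intros <;> linarith
  by_cases hp : N.label N.init = red
  swap
  · have : S 0 N.init = 0 := zero (i := 0) fun h => hp h.symm
    constructor <;> intros <;> linarith
  obtain ⟨g, hg⟩ := hg
  obtain ⟨b, hb⟩ := hb
  set p := N.init
  have hpb : p ≠ b := fun h => hrb (by rw [← hp, ← hb, h])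
  have hpg : p ≠ g := fun h => hrg (by rw [← hp, ← hg, h])
  have hbg' : b ≠ g := fun h => hbg (by rw [← hb, ← hg, h])
  -- Three colours already exhaust the three states, so each colour occurs exactly once.
  have huniv : ({p, b, g} : Finset N.State) = univ :=
    eq_of_subset_of_card_le (subset_univ _) (by
      rw [card_univ, card_eq_three.2 ⟨p, b, g, hpb, hpg, hbg', rfl⟩]; exact hN)
  have hcases : ∀ y : N.State, y = p ∨ y = b ∨ y = g := fun y => by
    simpa [← huniv] using mem_univ y
  have hsum : N.trans p p + N.trans p b + N.trans p g = 1 := by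
    have h := stdSimplex.sum_eq_one (N.trans p)
    rw [← huniv, sum_insert (by simp [hpb, hpg]), sum_pair hbg'] at h
    linarith
  have hS4 : ∀ y, y ≠ g → S 4 y = 0 := fun y hy => zero (i := 4) fun h => by
    change green = _ at h
    rcases hcases y with rfl | rfl | rfl
    · exact hrg (hp.symm.trans h.symm)
    · exact hbg (hb.symm.trans h.symm)
    · exact hy rfl
  have hS3 : ∀ y, y ≠ b → S 3 y = 0 := fun y hy => zero (i := 3) fun h => by
    change blue = _ at h
    rcases hcases y with rfl | rfl | rfl
    · exact hrb (hp.symm.trans h.symm)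
    · exact hy rfl
    · exact hbg (h.trans hg)
  have hSr : ∀ i : Fin 5, M.label i = red → ∀ y, y ≠ p → S i y = 0 := fun i hi y hy =>
    zero fun h => by
      rw [hi] at h
      rcases hcases y with rfl | rfl | rfl
      · exact hy rfl
      · exact hrb (h.trans hb)
      · exact hrg (h.trans hg)
  have step : ∀ (i : Fin 3) (q : N.State) (s : ℝ),
      (∀ y, y ≠ q → S (Fin.castLE (by norm_num) i.succ) y = 0) →
      S (Fin.castLE (by norm_num) i.succ) q ≤ s →
      S (Fin.castLE (by norm_num) i) p ≤
        s * min (79 / 100) (N.trans p q) + min (21 / 100) (N.trans p g) := by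
    intro i q s h0 hs
    obtain ⟨h1, h2, h3⟩ := exampleM_trans_red (red := red) (blue := blue) (green := green) i
    have := crossSim_le_of_unique M.toMarkovChain N.toMarkovChain (n := p) (p := q) (q := g)
      (m := (Fin.castLE (by norm_num) i : Fin 5))
      (j := (Fin.castLE (by norm_num) i.succ : Fin 5)) (k := (4 : Fin 5))
      (castLE_succ_ne_four i) h3 h0 hs hS4
    rwa [h1, h2] at this
  -- `m₁` and `m₂` are matched with `p`, and `m₃` with `b`. The similarity of `m₃` and `b` is only
  -- bounded by `1`, since `b` need not be absorbing.
  have hfin := step 0 p _ (hSr 1 rfl) (step 1 p _ (hSr 2 rfl) (step 2 b 1 hS3 (one 3 b)))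
  change S 0 p ≤ _ at hfin
  rw [one_mul] at hfin
  set x := min (79 / 100) (N.trans p p) with hx
  have hx0 : 0 ≤ x := le_min (by norm_num) (stdSimplex.zero_le _ _)
  have hle := hfin.trans (sim_le_opt hx0 (min_le_left _ _) (by
    linarith [min_le_right (79 / 100) (N.trans p p), min_le_right (79 / 100) (N.trans p b),
      min_le_right (21 / 100) (N.trans p g)]))
  have hpos : 0 < x + 2 * optLoop - 1 := by linarith
  have hprod : 0 ≤ (x - optLoop) ^ 2 * (x + 2 * optLoop - 1) :=
    mul_nonneg (sq_nonneg _) hpos.le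
  refine ⟨by linarith, fun h => ?_⟩
  have h0 : (x - optLoop) ^ 2 * (x + 2 * optLoop - 1) = 0 := by linarith
  have hxo : x = optLoop := by
    rcases mul_eq_zero.1 h0 with h0 | h0
    · exact sub_eq_zero.1 (pow_eq_zero_iff (by norm_num) |>.1 h0)
    · exact absurd h0 hpos.ne'
  -- Since `optLoop < 0.76`, the truncation at `79/100` is inactive and `x` is the actual loop
  -- probability.
  rcases min_choice (79 / 100) (N.trans p p) with h1 | h1
  · linarith
  · rw [← h1, ← hx, hxo]

/-- One coupling pattern serves all three red states: green mass is matched with green mass, and the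
remaining `79/100` is split between the loop and the blue state. Any coupling bounds the similarity
from below, so optimality need not be checked. -/
theorem chainDist_exampleN_le (h : 0 ≤ optLoop ∧ (0 : ℝ) ≤ 21 / 100 ∧ optLoop + 21 / 100 ≤ 1) :
    chainDist undiscounted (exampleM red blue green)
      (exampleN red blue green optLoop (21 / 100) h) ≤ 436 / 675 - 163 * √163 / 13500 := by
  have hopt := optLoop_bounds
  rw [chainDist_eq]
  set M := exampleM red blue green
  set N := exampleN red blue green optLoop (21 / 100) h
  let S : Fin 5 → Fin 3 → ℝ := crossSim M.toMarkovChain N.toMarkovChain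
  change 1 - S 0 0 ≤ _
  have S31 : S 3 1 = 1 := crossSim_eq_one M.toMarkovChain N.toMarkovChain rfl rfl rfl
  have S42 : S 4 2 = 1 := crossSim_eq_one M.toMarkovChain N.toMarkovChain rfl rfl rfl
  have nonneg : ∀ i j, 0 ≤ S i j := crossSim_nonneg M.toMarkovChain N.toMarkovChain
  have step : ∀ i : Fin 3,
      S (Fin.castLE (by norm_num) i.succ) 0 * optLoop +
        S (Fin.castLE (by norm_num) i.succ) 1 * (79 / 100 - optLoop) + S 4 2 * (21 / 100) ≤
        S (Fin.castLE (by norm_num) i) 0 := by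
    intro i
    let w : Fin 5 → Fin 3 → ℝ := fun a =>
      if a = Fin.castLE (by norm_num) i.succ then ![optLoop, 79 / 100 - optLoop, 0]
      else if a = 4 then ![0, 0, 21 / 100] else 0
    have wj : w (Fin.castLE (by norm_num) i.succ) = ![optLoop, 79 / 100 - optLoop, 0] := if_pos rfl
    have w4 : w 4 = ![0, 0, 21 / 100] := by
      simp only [w, (castLE_succ_ne_four i).symm, if_false, if_true]
    have w0 : ∀ x, x ≠ Fin.castLE (by norm_num) i.succ → x ≠ 4 → w x = 0 := fun x h1 h2 => by
      simp only [w, h1, h2, if_false]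
    obtain ⟨t1, t2, t0⟩ := exampleM_trans_red (red := red) (blue := blue) (green := green) i
    refine le_trans (le_of_eq ?_) (le_crossSim M.toMarkovChain N.toMarkovChain
      (m := (Fin.castLE (by norm_num) i : Fin 5)) (n := (0 : Fin 3))
      (by fin_cases i <;> rfl) w ?_ ?_ ?_)
    · change _ = ∑ x : Fin 5, ∑ y : Fin 3, S x y * w x y
      rw [Fintype.sum_eq_add _ _ (castLE_succ_ne_four i) fun x hx => by simp [w0 x hx.1 hx.2],
        wj, w4]
      simp [Fin.sum_univ_succ]
    · change ∀ (x : Fin 5) (y : Fin 3), 0 ≤ w x y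
      intro x y
      simp only [w]
      split_ifs
      · fin_cases y
        exacts [h.1, sub_nonneg.2 (by linarith), le_rfl]
      · fin_cases y
        exacts [le_rfl, le_rfl, h.2.1]
      · exact le_rfl
    · change ∀ x : Fin 5, ∑ y : Fin 3, w x y = _
      intro x
      by_cases hj : x = Fin.castLE (by norm_num) i.succ
      · subst hj
        rw [wj, t1]
        simp [Fin.sum_univ_succ]
      by_cases h4 : x = 4
      · subst h4
        rw [w4, t2]
        simp [Fin.sum_univ_succ]
      · rw [w0 x hj h4, t0 x hj h4]
        simp
    · change ∀ y : Fin 3, ∑ x : Fin 5, w x y = _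
      intro y
      rw [Fintype.sum_eq_add _ _ (castLE_succ_ne_four i) fun x hx => by simp [w0 x hx.1 hx.2],
        wj, w4]
      change _ = (!![optLoop, 1 - optLoop - 21 / 100, 21 / 100; 0, 1, 0; 0, 0, 1] :
        Matrix (Fin 3) (Fin 3) ℝ) 0 y
      fin_cases y <;> simp
      ring
  have h2 : S 3 0 * optLoop + S 3 1 * (79 / 100 - optLoop) + S 4 2 * (21 / 100) ≤ S 2 0 := step 2
  have h1 : S 2 0 * optLoop + S 2 1 * (79 / 100 - optLoop) + S 4 2 * (21 / 100) ≤ S 1 0 := step 1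
  have h0 : S 1 0 * optLoop + S 1 1 * (79 / 100 - optLoop) + S 4 2 * (21 / 100) ≤ S 0 0 := step 0
  -- Mass pairing a red state with the blue `n₁` earns nothing; for a lower bound it suffices that
  -- its contribution is nonnegative.
  have drop : ∀ i j, 0 ≤ S i j * (79 / 100 - optLoop) := fun i j =>
    mul_nonneg (nonneg i j) (by linarith)
  rw [S42] at h0 h1 h2
  rw [S31] at h2
  have k2 : 79 / 100 - optLoop + 21 / 100 ≤ S 2 0 := by
    linarith [mul_nonneg (nonneg 3 0) h.1]
  have k1 : optLoop * (79 / 100 - optLoop + 21 / 100) + 21 / 100 ≤ S 1 0 := by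
    linarith [mul_le_mul_of_nonneg_left k2 h.1, drop 2 1]
  have k0 := mul_le_mul_of_nonneg_left k1 h.1
  have e := one_sub_cubic_eq optLoop
  rw [sub_self, zero_pow two_ne_zero, zero_mul] at e
  linarith [drop 1 1]

end Example

end MarkovApprox

theorem mainTheorem9 {L : Type*} (red blue green : L)
    (hrb : red ≠ blue) (hrg : red ≠ green) (hbg : blue ≠ green)
    (x y : ℝ) (hx : x = (1 / 30) * (10 + Real.sqrt 163)) (hy : y = 21 / 100) :
    Fintype.card (MarkovApprox.exampleM red blue green).State = 5 ∧
    (MarkovApprox.exampleM red blue green).IsRational ∧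
    (∃ hxy : 0 ≤ x ∧ 0 ≤ y ∧ x + y ≤ 1,
      Fintype.card (MarkovApprox.exampleN red blue green x y hxy).State = 3 ∧
      MarkovApprox.IsClosestApproximant MarkovApprox.undiscounted
        (MarkovApprox.exampleM red blue green) 3
        (MarkovApprox.exampleN red blue green x y hxy) ∧
      MarkovApprox.chainDist MarkovApprox.undiscounted
        (MarkovApprox.exampleM red blue green)
        (MarkovApprox.exampleN red blue green x y hxy)
          = 436 / 675 - 163 * Real.sqrt 163 / 13500) ∧
    Irrational (436 / 675 - 163 * Real.sqrt 163 / 13500) ∧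
    (∀ N : MarkovApprox.PointedMarkovChain L,
      MarkovApprox.IsClosestApproximant MarkovApprox.undiscounted
        (MarkovApprox.exampleM red blue green) 3 N →
      ∃ m n : N.State, Irrational (N.trans m n)) := by
  obtain rfl : x = MarkovApprox.optLoop := hx
  subst hy
  have hopt := MarkovApprox.optLoop_bounds
  have hxy : 0 ≤ MarkovApprox.optLoop ∧ (0 : ℝ) ≤ 21 / 100 ∧
      MarkovApprox.optLoop + 21 / 100 ≤ 1 :=
    ⟨by linarith, by norm_num, by linarith⟩
  have hle := MarkovApprox.chainDist_exampleN_le (red := red) (blue := blue) (green := green) hxy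
  have hge := MarkovApprox.optDist_le hrb hrg hbg
  have hcard : Fintype.card
      (MarkovApprox.exampleN red blue green MarkovApprox.optLoop (21 / 100) hxy).State = 3 :=
    Fintype.card_fin 3
  refine ⟨Fintype.card_fin 5, MarkovApprox.exampleM_isRational,
    ⟨hxy, hcard, ⟨hcard.le, fun N' hN' => hle.trans (hge N' hN').1⟩,
      le_antisymm hle (hge _ hcard.le).1⟩, MarkovApprox.irrational_optDist, fun N hN => ?_⟩
  -- A closest approximant is no farther away than the explicit chain, so it attains the bound, and
  -- the equality case fixes its loop probability.
  refine ⟨N.init, N.init, ?_⟩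
  rw [(hge N hN.1).2 ((hN.2 _ hcard.le).trans hle)]
  exact MarkovApprox.irrational_optLoop
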